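/- Let $a\ge 1$ and $n\ge 1$ be integers. Let $V_{n-1}=\{x\in\mathbb R^n: x_1+\cdots+x_n=0\}$ and let $\mathcal A^{a,a}_{n-1}$ be the $a$-Catalan arrangement, i.e. the set of hyperplanes $x_i-x_j=k$ in $V_{n-1}$ with $1\le i<j\le n$ and $k\in\{1-a,2-a,\ldots,a-1\}$. Its regions are the connected components of the complement in $V_{n-1}$ of the union of its hyperplanes. A weighted digraph on $\{1,\ldots,n\}$ is given by a weight function $w:\{1,\ldots,n\}^2\to\mathbb R\cup\{-\infty\}$, where $w(i,j)$ is the weight of the edge $i\to j$, and $w(i,j)=-\infty$ means that there is no such edge. It is valid (for $\mathcal A^{a,a}_{n-1}$) if $w(i,i)=-\infty$ for all $i$ and, for all $i<j$, one of the following holds: $w(i,j)=-\infty$ and $w(j,i)=a-1$; or $w(i,j)=k$ and $w(j,i)=-k-1$ for some integer $k$ with $1-a\le k\le a-2$; or $w(i,j)=a-1$ and $w(j,i)=-\infty$. It is $m$-acyclic if it has no directed cycle along which the sum of the weights is nonnegative. The polytope of $w$ is the set of all $x\in V_{n-1}$ with $w(i,j)<x_i-x_j$ for all edges $i\to j$.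 An $a$-Catalan path with $n$ up steps is a lattice path from $(0,0)$ to $(an,0)$ with $n$ up steps $(1,a-1)$ and $(a-1)n$ down steps $(1,-1)$ that stays weakly above the horizontal axis. Given a permutation $\pi$ of $\{1,\ldots,n\}$ and an $a$-Catalan path $\Lambda$ with $n$ up steps, label the $i$-th up step from the left with $\pi(i)$, and let $\ell(\pi(i))$ be the height of its lower end. The weighted digraph encoded by $(\pi,\Lambda)$ has no loops and is defined for $i<j$ by $$w(\pi(i),\pi(j))=\begin{cases}\ell(\pi(j))-\ell(\pi(i)) & \text{if } 1-a\le \ell(\pi(j))-\ell(\pi(i))\le a-1,\\ -\infty & \text{if } \ell(\pi(j))-\ell(\pi(i))<1-a,\\ a-1 & \text{if } \ell(\pi(j))-\ell(\pi(i))>a-1,\end{cases}$$ $$w(\pi(j),\pi(i))=\begin{cases}-1-w(\pi(i),\pi(j)) & \text{if } w(\pi(i),\pi(j))\in[1-a,a-2],\\ -\infty & \text{if } w(\pi(i),\pi(j))=a-1,\\ a-1 & \text{if } w(\pi(i),\pi(j))=-\infty.\end{cases}$$ Theorem. The map sending $(\pi,\Lambda)$ to the weighted digraph encoded by it is a bijection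 from the set of all pairs $(\pi,\Lambda)$, where $\pi$ is a permutation of $\{1,\ldots,n\}$ and $\Lambda$ is an $a$-Catalan path with $n$ up steps, onto the set of all valid $m$-acyclic weighted digraphs on $\{1,\ldots,n\}$. Consequently, sending $(\pi,\Lambda)$ to the polytope of the weighted digraph encoded by it is a bijection from the set of these pairs onto the set of regions of $\mathcal A^{a,a}_{n-1}$. -/

import Mathlib

namespace BraidDeformation

/-- A deformation of the braid arrangement on `n` coordinates: for each pair `i < j` the finite
set of numbers `c` such that `x i - x j = c` is a hyperplane of the arrangement. Only the values
at pairs with `i < j` are ever used. -/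
abbrev Deformation (n : ℕ) := Fin n → Fin n → Finset ℝ

/-- The truncated affine arrangement `A^{a,b}_{n-1}`, with the hyperplanes
`x i - x j = 1 - a, 2 - a, …, b - 1` for `i < j`. The `a`-Catalan arrangement is `A^{a,a}_{n-1}`. -/
noncomputable def truncatedAffine (n : ℕ) (a b : ℤ) : Deformation n :=
  fun _ _ => (Finset.Icc (1 - a) (b - 1)).image (fun k : ℤ => (k : ℝ))

/-- The complement of the union of the hyperplanes in the space `V_{n-1}` of all vectors whose
coordinates add up to zero. -/
def complement {n : ℕ} (A : Deformation n) : Set (Fin n → ℝ) :=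
  {x | ∑ i, x i = 0 ∧ ∀ i j, i < j → ∀ c ∈ A i j, x i - x j ≠ c}

/-- The regions of the arrangement: the connected components of the complement. -/
def regions {n : ℕ} (A : Deformation n) : Set (Set (Fin n → ℝ)) :=
  {R | ∃ x ∈ complement A, R = connectedComponentIn (complement A) x}

/-- A weighted digraph on `n` vertices, given by its weight function: `w i j` is the weight of the
directed edge `i → j`, and `w i j = ⊥` (that is, `-∞`) if there is no such edge. -/
abbrev WeightedDigraph (n : ℕ) := Fin n → Fin n → WithBot ℝ

/-- Valid weighted digraphs of a deformation. There are no loops and, for `i < j`, either there are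
no hyperplanes and no edges between `i` and `j`, or there is only an edge `j → i` whose weight is
minus the least element of `A i j`, or there are edges `i → j` of weight `c` and `j → i` of weight
`-d` where `c < d` are consecutive elements of `A i j`, or there is only an edge `i → j` whose
weight is the greatest element of `A i j`. -/
def IsValid {n : ℕ} (A : Deformation n) (w : WeightedDigraph n) : Prop :=
  (∀ i, w i i = ⊥) ∧
  ∀ i j, i < j →
    (A i j = ∅ ∧ w i j = ⊥ ∧ w j i = ⊥) ∨
    (∃ c, IsLeast (A i j : Set ℝ) c ∧ w i j = ⊥ ∧ w j i = ((-c : ℝ) : WithBot ℝ)) ∨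
    (∃ c ∈ A i j, ∃ d ∈ A i j, c < d ∧ (∀ e ∈ A i j, ¬ (c < e ∧ e < d)) ∧
      w i j = (c : WithBot ℝ) ∧ w j i = ((-d : ℝ) : WithBot ℝ)) ∨
    (∃ c, IsGreatest (A i j : Set ℝ) c ∧ w i j = (c : WithBot ℝ) ∧ w j i = ⊥)

/-- `c 0 → c 1 → ⋯ → c m → c 0` is a directed cycle (the sum `k + 1` is taken modulo `m + 1`). -/
def IsDirectedCycle {n : ℕ} (w : WeightedDigraph n) {m : ℕ} (c : Fin (m + 1) → Fin n) : Prop :=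
  Function.Injective c ∧ ∀ k, w (c k) (c (k + 1)) ≠ ⊥

/-- A directed cycle is `m`-ascending if the sum of its weights is nonnegative. -/
def IsAscendingCycle {n : ℕ} (w : WeightedDigraph n) {m : ℕ} (c : Fin (m + 1) → Fin n) : Prop :=
  IsDirectedCycle w c ∧ 0 ≤ ∑ k, w (c k) (c (k + 1))

/-- A weighted digraph is `m`-acyclic if it has no `m`-ascending cycle. -/
def IsMAcyclic {n : ℕ} (w : WeightedDigraph n) : Prop :=
  ∀ (m : ℕ) (c : Fin (m + 1) → Fin n), ¬ IsAscendingCycle w c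

/-- The weighted digraphical polytope in `V_{n-1}` of a weighted digraph. An edge `i → j` of weight
`w i j` stands for the inequality `w i j < x i - x j`; thus, for `i < j`, the edge `i → j` gives a
lower bound `w i j` and the edge `j → i` gives an upper bound `-(w j i)` for `x i - x j`. An absent
edge, of weight `⊥`, imposes no condition. -/
def polytope {n : ℕ} (w : WeightedDigraph n) : Set (Fin n → ℝ) :=
  {x | ∑ i, x i = 0 ∧ ∀ i j, w i j < ((x i - x j : ℝ) : WithBot ℝ)}

/-- The final height of a lattice path that starts at height `0` and has the given steps, where
`true` is an up step `(1, a - 1)` and `false` is a down step `(1, -1)`. -/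
def height (a : ℕ) (s : List Bool) : ℤ :=
  (s.map fun b => if b then (a : ℤ) - 1 else -1).sum

/-- `a`-Catalan paths with `n` up steps: lattice paths from `(0, 0)` to `(a n, 0)` with `n` up steps
`(1, a - 1)` and `(a - 1) n` down steps `(1, -1)` that stay weakly above the horizontal axis. -/
structure CatalanPath (a n : ℕ) where
  steps : List Bool
  count_up : steps.count true = n
  count_down : (steps.count false : ℤ) = ((a : ℤ) - 1) * n
  nonneg : ∀ k, 0 ≤ height a (steps.take k)

/-- The level of the lower end of the up step number `i` (counted from the left, starting at `0`):
the height reached after all steps before it. -/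
noncomputable def CatalanPath.upLevel {a n : ℕ} (Λ : CatalanPath a n) (i : Fin n) : ℤ :=
  height a (Λ.steps.take (Nat.nth (fun k => Λ.steps[k]? = some true) i))

/-- The level function of a labeled path: up step number `i` carries the label `π i`. -/
noncomputable def level {a n : ℕ} (π : Equiv.Perm (Fin n)) (Λ : CatalanPath a n) (v : Fin n) : ℤ :=
  Λ.upLevel (π.symm v)

/-- The weight `w u v` when the up step labeled `u` precedes the one labeled `v` and
`d = level v - level u`. -/
def forwardWeight (a : ℕ) (d : ℤ) : WithBot ℤ :=
  if d < 1 - (a : ℤ) then ⊥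
  else if (a : ℤ) - 1 < d then (((a : ℤ) - 1 : ℤ) : WithBot ℤ)
  else (d : WithBot ℤ)

/-- The weight of `v → u` in terms of the weight of `u → v`. -/
def reverseWeight (a : ℕ) : WithBot ℤ → WithBot ℤ
  | ⊥ => (((a : ℤ) - 1 : ℤ) : WithBot ℤ)
  | (x : ℤ) => if x = (a : ℤ) - 1 then ⊥ else ((-1 - x : ℤ) : WithBot ℤ)

/-- The weighted digraph encoded by the pair `(π, Λ)`. The label `u` precedes the label `v` on the
path if and only if `π.symm u < π.symm v`. -/
noncomputable def encode {a n : ℕ} (π : Equiv.Perm (Fin n)) (Λ : CatalanPath a n) :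
    WeightedDigraph n := fun u v =>
  if u = v then ⊥
  else if π.symm u < π.symm v then
    (forwardWeight a (level π Λ v - level π Λ u)).map (fun k : ℤ => (k : ℝ))
  else
    (reverseWeight a (forwardWeight a (level π Λ u - level π Λ v))).map (fun k : ℤ => (k : ℝ))

end BraidDeformation

/-!
# Regions of the `a`-Catalan arrangement and labeled `a`-Catalan paths

A point `x` off the hyperplanes has a digraph `cellDigraph a x`: the weight of `i → j` is the integer
part of `x i - x j`, replaced by `a - 1` if it is larger, and there is no edge if it is below `1 - a`.
The region of `x` is the polytope of this digraph (`connectedComponentIn_eq_polytope`), and a valid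
digraph is recovered from any point of its polytope (`eq_cellDigraph_of_mem_polytope`). A valid digraph is `m`-acyclic exactly when its polytope
is nonempty: summing the inequalities around a cycle gives one direction, and suprema over simple
paths give a potential for the other (`polytope_nonempty_of_isMAcyclic`). So both bijections follow
once the encoded digraphs are known to be exactly the digraphs of points, each encoded only once.

Put `y = -x`. A path whose up steps have levels `ℓ` describes the point `y` in which vertex `v` has
integer part `ℓ v`, the fractional parts being ordered as the labels along the path
(`exists_encode_eq_cellDigraph`). The level sequences `L` of `a`-Catalan paths are those with
`L 0 = 0`, `0 ≤ L i` and `L (i + 1) ≤ L i + a - 1`.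

Conversely, the integer and fractional parts of any `y` give levels and an order with the right
digraph, and two moves that preserve the digraph make the levels into a level sequence: if the first
level is positive, the first vertex moves to the end with its level decreased by `1`; if a level
exceeds its predecessor by at least `a`, the two vertices are exchanged, which changes their
difference only in the range where it is cut off. A minimal configuration admits no such move
(`exists_isLevelSequence`).

For uniqueness, let two labeled level sequences with the same digraph agree up to some position.
Every vertex `z` further on at a height below `ℓ + a - 1`, where `ℓ` is the last common level, has
its level determined by comparison with a vertex of the common part (`AgreeBelow.exists_compare`).
If the sequences continued with different vertices, at levels `h ≤ h'`, then either `h = h'` and the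
two vertices compare differently, or the first sequence is confined to heights at most `h' - a` until
it reaches the vertex chosen by the second one, which is at height at least `h'`
(`AgreeBelow.next_eq`).
-/

namespace BraidDeformation

/-! ### Truncated weights -/

/-- The weight of an edge `u → v` when the integer part of `x u - x v` is `d`: the largest
`k ∈ {1 - a, …, a - 1}` with `k ≤ d`, or `⊥` if there is none. -/
noncomputable def truncWeight (a : ℕ) (d : ℤ) : WithBot ℝ :=
  (forwardWeight a d).map (fun k : ℤ => (k : ℝ))

lemma truncWeight_of_lt {a : ℕ} {d : ℤ} (h : d < 1 - (a : ℤ)) : truncWeight a d = ⊥ := by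
  simp [truncWeight, forwardWeight, h]

lemma truncWeight_of_le {a : ℕ} {d : ℤ} (h : 1 - (a : ℤ) ≤ d) :
    truncWeight a d = (((min d ((a : ℤ) - 1) : ℤ) : ℝ) : WithBot ℝ) := by
  unfold truncWeight forwardWeight
  rw [if_neg (by omega)]
  split_ifs with h2
  · rw [min_eq_right (by omega)]; rfl
  · rw [min_eq_left (by omega)]; rfl

lemma truncWeight_lt_coe_iff {a : ℕ} (ha : 1 ≤ a) {d : ℤ} {r : ℝ} :
    truncWeight a d < (r : WithBot ℝ) ↔
      ∀ k : ℤ, 1 - (a : ℤ) ≤ k → k ≤ (a : ℤ) - 1 → k ≤ d → (k : ℝ) < r := by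
  rcases lt_or_ge d (1 - (a : ℤ)) with h | h
  · rw [truncWeight_of_lt h]
    simp only [WithBot.bot_lt_coe, true_iff]
    intro k _ _ _; omega
  · rw [truncWeight_of_le h, WithBot.coe_lt_coe]
    constructor
    · intro h1 k _ hk2 hk3
      have : k ≤ min d ((a : ℤ) - 1) := le_min hk3 hk2
      exact lt_of_le_of_lt (by exact_mod_cast this) h1
    · intro h1
      exact h1 _ (by omega) (by omega) (by omega)

lemma truncWeight_eq_iff {a : ℕ} (ha : 1 ≤ a) {d e : ℤ} :
    truncWeight a d = truncWeight a e ↔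
      ∀ k : ℤ, 1 - (a : ℤ) ≤ k → k ≤ (a : ℤ) - 1 → (k ≤ d ↔ k ≤ e) := by
  rcases lt_or_ge d (1 - (a : ℤ)) with hd | hd <;> rcases lt_or_ge e (1 - (a : ℤ)) with he | he
  · rw [truncWeight_of_lt hd, truncWeight_of_lt he]
    simp only [true_iff]
    intro k _ _; omega
  · rw [truncWeight_of_lt hd, truncWeight_of_le he]
    simp only [WithBot.bot_ne_coe, false_iff]
    intro h
    have := h (1 - a) (by omega) (by omega)
    omega
  · rw [truncWeight_of_le hd, truncWeight_of_lt he]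
    simp only [WithBot.coe_ne_bot, false_iff]
    intro h
    have := h (1 - a) (by omega) (by omega)
    omega
  · rw [truncWeight_of_le hd, truncWeight_of_le he, WithBot.coe_inj, Int.cast_inj]
    constructor
    · intro h k _ _; omega
    · intro h
      have h1 := h (min d (a - 1)) (by omega) (by omega)
      have h2 := h (min e (a - 1)) (by omega) (by omega)
      omega

lemma truncWeight_congr {a : ℕ} (ha : 1 ≤ a) {d e : ℤ}
    (h : d = e ∨ ((a : ℤ) - 1 ≤ d ∧ (a : ℤ) - 1 ≤ e) ∨ (d ≤ -(a : ℤ) ∧ e ≤ -(a : ℤ))) :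
    truncWeight a d = truncWeight a e := by
  rw [truncWeight_eq_iff ha]
  intro k _ _
  omega

/-- `reverseWeight` turns the weight for integer part `e` into that for `-1 - e`, the integer part
of the opposite difference. -/
lemma reverseWeight_forwardWeight {a : ℕ} (ha : 1 ≤ a) (e : ℤ) :
    (reverseWeight a (forwardWeight a e)).map (fun k : ℤ => (k : ℝ)) =
      truncWeight a (-1 - e) := by
  rcases lt_or_ge e (1 - (a : ℤ)) with h | h
  · rw [truncWeight_of_le (by omega), min_eq_right (by omega)]
    simp [forwardWeight, h, reverseWeight]
  · rcases lt_or_ge e ((a : ℤ) - 1) with h2 | h2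
    · rw [truncWeight_of_le (by omega), min_eq_left (by omega)]
      have : forwardWeight a e = (e : WithBot ℤ) := by
        unfold forwardWeight
        rw [if_neg (by omega), if_neg (by omega)]
      rw [this]
      simp only [reverseWeight]
      rw [if_neg (by omega)]
      rfl
    · rw [truncWeight_of_lt (show -1 - e < 1 - (a : ℤ) by omega)]
      have : forwardWeight a e = (((a : ℤ) - 1 : ℤ) : WithBot ℤ) := by
        unfold forwardWeight
        rw [if_neg (by omega)]
        split_ifs
        · rfl
        · congr 1; omega
      rw [this]
      simp [reverseWeight]

/-- A difference `r` that satisfies the inequalities of both edges between two vertices lies on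
none of the hyperplanes, and its integer part gives the weight back. -/
lemma truncWeight_floor_of_lt {a : ℕ} (ha : 1 ≤ a) {d : ℤ} {r : ℝ}
    (h1 : truncWeight a d < (r : WithBot ℝ))
    (h2 : truncWeight a (-1 - d) < ((-r : ℝ) : WithBot ℝ)) :
    truncWeight a ⌊r⌋ = truncWeight a d ∧
      ∀ k : ℤ, 1 - (a : ℤ) ≤ k → k ≤ (a : ℤ) - 1 → r ≠ k := by
  rw [truncWeight_lt_coe_iff ha] at h1 h2
  have h3 : ∀ k : ℤ, 1 - (a : ℤ) ≤ k → k ≤ (a : ℤ) - 1 → d < k → r < k := by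
    intro k hk1 hk2 hk
    have := h2 (-k) (by omega) (by omega) (by omega)
    push_cast at this
    linarith
  constructor
  · rw [truncWeight_eq_iff ha]
    intro k hk1 hk2
    rw [Int.le_floor]
    constructor
    · intro h
      by_contra hc
      exact absurd (h3 k hk1 hk2 (by omega)) (by linarith)
    · intro h
      exact (h1 k hk1 hk2 h).le
  · intro k hk1 hk2
    rcases le_or_gt k d with h | h
    · exact (h1 k hk1 hk2 h).ne'
    · exact (h3 k hk1 hk2 h).ne

lemma truncWeight_floor_lt {a : ℕ} (ha : 1 ≤ a) {r : ℝ}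
    (h : ∀ k : ℤ, 1 - (a : ℤ) ≤ k → k ≤ (a : ℤ) - 1 → r ≠ k) :
    truncWeight a ⌊r⌋ < (r : WithBot ℝ) := by
  rw [truncWeight_lt_coe_iff ha]
  intro k hk1 hk2 hk
  exact lt_of_le_of_ne (Int.le_floor.1 hk) (h k hk1 hk2).symm

lemma truncWeight_floor_neg {a : ℕ} (ha : 1 ≤ a) {r : ℝ}
    (h : ∀ k : ℤ, 1 - (a : ℤ) ≤ k → k ≤ (a : ℤ) - 1 → r ≠ k) :
    truncWeight a ⌊-r⌋ = truncWeight a (-1 - ⌊r⌋) := by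
  rw [truncWeight_eq_iff ha]
  intro k hk1 hk2
  have hne := h (-k) (by omega) (by omega)
  push_cast at hne
  rw [Int.le_floor]
  have : k ≤ -1 - ⌊r⌋ ↔ ⌊r⌋ < -k := by omega
  rw [this, Int.floor_lt]
  push_cast
  constructor
  · intro h
    exact lt_of_le_of_ne (by linarith) hne
  · intro h; linarith

/-! ### Points off the hyperplanes and their digraphs -/

/-- `x` lies on no hyperplane `x i - x j = k` with `|k| < a`; the sum of the coordinates is
arbitrary. -/
def AvoidsHyperplanes {n : ℕ} (a : ℕ) (x : Fin n → ℝ) : Prop :=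
  ∀ i j, i ≠ j → ∀ k : ℤ, 1 - (a : ℤ) ≤ k → k ≤ (a : ℤ) - 1 → x i - x j ≠ k

lemma mem_complement_iff {n a : ℕ} {x : Fin n → ℝ} :
    x ∈ complement (truncatedAffine n a a) ↔ ∑ i, x i = 0 ∧ AvoidsHyperplanes a x := by
  constructor
  · rintro ⟨h0, h⟩
    refine ⟨h0, ?_⟩
    intro i j hij k hk1 hk2 he
    rcases lt_or_gt_of_ne hij with hlt | hlt
    · exact h i j hlt k (Finset.mem_image.2 ⟨k, Finset.mem_Icc.2 ⟨hk1, hk2⟩, rfl⟩) he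
    · refine h j i hlt ((-k : ℤ) : ℝ)
        (Finset.mem_image.2 ⟨-k, Finset.mem_Icc.2 ⟨by omega, by omega⟩, rfl⟩) ?_
      push_cast
      linarith
  · rintro ⟨h0, h⟩
    refine ⟨h0, ?_⟩
    intro i j hij c hc
    obtain ⟨k, hk, rfl⟩ := Finset.mem_image.1 hc
    rw [Finset.mem_Icc] at hk
    exact h i j hij.ne k hk.1 hk.2

/-- The weighted digraph whose edge `i → j` carries the best lower bound on `x i - x j` provided by
the hyperplanes. -/
noncomputable def cellDigraph {n : ℕ} (a : ℕ) (x : Fin n → ℝ) : WeightedDigraph n :=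
  fun i j => if i = j then ⊥ else truncWeight a ⌊x i - x j⌋

lemma mem_truncatedAffine {n a : ℕ} {i j : Fin n} {c : ℝ} :
    c ∈ truncatedAffine n a a i j ↔ ∃ k : ℤ, (1 - (a : ℤ) ≤ k ∧ k ≤ (a : ℤ) - 1) ∧ (k : ℝ) = c := by
  simp [truncatedAffine]

lemma isValid_iff {n a : ℕ} (ha : 1 ≤ a) {w : WeightedDigraph n} :
    IsValid (truncatedAffine n a a) w ↔ (∀ i, w i i = ⊥) ∧
      ∀ i j, i ≠ j → ∃ d : ℤ, w i j = truncWeight a d ∧ w j i = truncWeight a (-1 - d) := by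
  constructor
  · rintro ⟨h0, h⟩
    refine ⟨h0, ?_⟩
    have key : ∀ i j, i < j →
        ∃ d : ℤ, w i j = truncWeight a d ∧ w j i = truncWeight a (-1 - d) := by
      intro i j hij
      rcases h i j hij with ⟨h1, -⟩ | ⟨c, hc, h1, h2⟩ | ⟨c, hc, d, hd, hcd, hno, h1, h2⟩ |
        ⟨c, hc, h1, h2⟩
      · have : ((1 - (a : ℤ) : ℤ) : ℝ) ∈ truncatedAffine n a a i j :=
          mem_truncatedAffine.2 ⟨1 - a, ⟨le_rfl, by omega⟩, rfl⟩
        rw [h1] at this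
        simp at this
      · have hm : ((1 - (a : ℤ) : ℤ) : ℝ) ∈ truncatedAffine n a a i j :=
          mem_truncatedAffine.2 ⟨1 - a, ⟨le_rfl, by omega⟩, rfl⟩
        have hle := hc.2 hm
        obtain ⟨k, hk, rfl⟩ := mem_truncatedAffine.1 hc.1
        have hk' : k = 1 - a := by
          have : k ≤ 1 - (a : ℤ) := by exact_mod_cast hle
          omega
        refine ⟨-a, ?_, ?_⟩
        · rw [h1, truncWeight_of_lt (by omega)]
        · rw [h2, truncWeight_of_le (by omega), min_eq_left (by omega), hk']
          congr 1; push_cast; ring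
      · obtain ⟨k, hk, rfl⟩ := mem_truncatedAffine.1 hc
        obtain ⟨l, hl, rfl⟩ := mem_truncatedAffine.1 hd
        have hkl : k < l := by exact_mod_cast hcd
        have hl' : l = k + 1 := by
          by_contra hne
          refine hno ((k + 1 : ℤ) : ℝ)
            (mem_truncatedAffine.2 ⟨k + 1, ⟨by omega, by omega⟩, rfl⟩) ⟨?_, ?_⟩
          · exact_mod_cast (by omega : k < k + 1)
          · exact_mod_cast (by omega : k + 1 < l)
        refine ⟨k, ?_, ?_⟩
        · rw [h1, truncWeight_of_le (by omega), min_eq_left (by omega)]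
        · rw [h2, truncWeight_of_le (by omega), min_eq_left (by omega), hl']
          congr 1; push_cast; ring
      · have hm : (((a : ℤ) - 1 : ℤ) : ℝ) ∈ truncatedAffine n a a i j :=
          mem_truncatedAffine.2 ⟨a - 1, ⟨by omega, le_rfl⟩, rfl⟩
        have hle := hc.2 hm
        obtain ⟨k, hk, rfl⟩ := mem_truncatedAffine.1 hc.1
        have hk' : k = a - 1 := by
          have : (a : ℤ) - 1 ≤ k := by exact_mod_cast hle
          omega
        refine ⟨a - 1, ?_, ?_⟩
        · rw [h1, truncWeight_of_le (by omega), min_eq_left (by omega), hk']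
        · rw [h2, truncWeight_of_lt (by omega)]
    intro i j hij
    rcases lt_or_gt_of_ne hij with hlt | hlt
    · exact key i j hlt
    · obtain ⟨d, h1, h2⟩ := key j i hlt
      exact ⟨-1 - d, h2, by rw [h1]; congr 1; ring⟩
  · rintro ⟨h0, h⟩
    refine ⟨h0, ?_⟩
    intro i j hij
    obtain ⟨d, h1, h2⟩ := h i j hij.ne
    right
    rcases lt_or_ge d (1 - (a : ℤ)) with hd | hd
    · left
      refine ⟨((1 - (a : ℤ) : ℤ) : ℝ),
        ⟨mem_truncatedAffine.2 ⟨1 - a, ⟨le_rfl, by omega⟩, rfl⟩, ?_⟩, ?_, ?_⟩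
      · intro c hc
        obtain ⟨k, hk, rfl⟩ := mem_truncatedAffine.1 hc
        exact_mod_cast hk.1
      · rw [h1, truncWeight_of_lt hd]
      · rw [h2, truncWeight_of_le (by omega), min_eq_right (by omega)]
        congr 1; push_cast; ring
    · right
      rcases lt_or_ge d ((a : ℤ) - 1) with hd2 | hd2
      · left
        refine ⟨(d : ℝ), mem_truncatedAffine.2 ⟨d, ⟨by omega, by omega⟩, rfl⟩,
          ((d + 1 : ℤ) : ℝ), mem_truncatedAffine.2 ⟨d + 1, ⟨by omega, by omega⟩, rfl⟩, ?_, ?_, ?_, ?_⟩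
        · exact_mod_cast (by omega : d < d + 1)
        · intro c hc
          obtain ⟨k, hk, rfl⟩ := mem_truncatedAffine.1 hc
          rintro ⟨e1, e2⟩
          have e1' : d < k := by exact_mod_cast e1
          have e2' : k < d + 1 := by exact_mod_cast e2
          omega
        · rw [h1, truncWeight_of_le (by omega), min_eq_left (by omega)]
        · rw [h2, truncWeight_of_le (by omega), min_eq_left (by omega)]
          congr 1; push_cast; ring
      · right
        refine ⟨(((a : ℤ) - 1 : ℤ) : ℝ),
          ⟨mem_truncatedAffine.2 ⟨a - 1, ⟨by omega, le_rfl⟩, rfl⟩, ?_⟩, ?_, ?_⟩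
        · intro c hc
          obtain ⟨k, hk, rfl⟩ := mem_truncatedAffine.1 hc
          exact_mod_cast hk.2
        · rw [h1, truncWeight_of_le (by omega), min_eq_right (by omega)]
        · rw [h2, truncWeight_of_lt (by omega)]

lemma isValid_cellDigraph {n a : ℕ} (ha : 1 ≤ a) {x : Fin n → ℝ} (hx : AvoidsHyperplanes a x) :
    IsValid (truncatedAffine n a a) (cellDigraph a x) := by
  rw [isValid_iff ha]
  refine ⟨fun i => by simp [cellDigraph], ?_⟩
  intro i j hij
  refine ⟨⌊x i - x j⌋, by simp [cellDigraph, hij], ?_⟩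
  rw [← truncWeight_floor_neg ha (hx i j hij)]
  simp [cellDigraph, hij.symm]

lemma mem_polytope_cellDigraph {n a : ℕ} (ha : 1 ≤ a) {x : Fin n → ℝ} (h0 : ∑ i, x i = 0)
    (hx : AvoidsHyperplanes a x) : x ∈ polytope (cellDigraph a x) := by
  refine ⟨h0, fun i j => ?_⟩
  by_cases hij : i = j
  · simp [cellDigraph, hij]
  · simp only [cellDigraph, hij, if_false]
    exact truncWeight_floor_lt ha (hx i j hij)

/-- A valid digraph is determined by any point of its polytope. -/
lemma eq_cellDigraph_of_mem_polytope {n a : ℕ} (ha : 1 ≤ a) {w : WeightedDigraph n}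
    (hw : IsValid (truncatedAffine n a a) w) {x : Fin n → ℝ} (hx : x ∈ polytope w) :
    w = cellDigraph a x ∧ AvoidsHyperplanes a x := by
  rw [isValid_iff ha] at hw
  have key : ∀ i j, i ≠ j → w i j = truncWeight a ⌊x i - x j⌋ ∧
      ∀ k : ℤ, 1 - (a : ℤ) ≤ k → k ≤ (a : ℤ) - 1 → x i - x j ≠ k := by
    intro i j hij
    obtain ⟨d, h1, h2⟩ := hw.2 i j hij
    have e1 := hx.2 i j
    have e2 := hx.2 j i
    rw [h1] at e1
    rw [h2, ← neg_sub (x i) (x j)] at e2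
    obtain ⟨h3, h4⟩ := truncWeight_floor_of_lt ha e1 e2
    exact ⟨h1.trans h3.symm, h4⟩
  refine ⟨?_, fun i j hij => (key i j hij).2⟩
  funext i j
  by_cases hij : i = j
  · subst hij; simp [cellDigraph, hw.1]
  · simp only [cellDigraph, hij, if_false]
    exact (key i j hij).1

/-! ### Regions are polytopes -/

lemma convex_polytope {n : ℕ} (w : WeightedDigraph n) : Convex ℝ (polytope w) := by
  intro x hx y hy s t hs ht hst
  refine ⟨?_, fun i j => ?_⟩
  · simp only [Pi.add_apply, Pi.smul_apply, smul_eq_mul, Finset.sum_add_distrib, ← Finset.mul_sum,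
      hx.1, hy.1]
    simp
  · have h1 := hx.2 i j
    have h2 := hy.2 i j
    rcases hw : w i j with _ | c
    · exact WithBot.bot_lt_coe _
    · rw [hw] at h1 h2
      replace h1 : c < x i - x j := WithBot.coe_lt_coe.1 h1
      replace h2 : c < y i - y j := WithBot.coe_lt_coe.1 h2
      refine WithBot.coe_lt_coe.2 ?_
      simp only [Pi.add_apply, Pi.smul_apply, smul_eq_mul]
      have := convex_Ioi c h1 h2 hs ht hst
      simp only [smul_eq_mul, Set.mem_Ioi] at this
      linarith

/-- The region of a point is the polytope of its digraph: the polytope is convex and avoids the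
hyperplanes, and no hyperplane can be crossed within a region. -/
lemma connectedComponentIn_eq_polytope {n a : ℕ} (ha : 1 ≤ a) {x : Fin n → ℝ}
    (hx : x ∈ complement (truncatedAffine n a a)) :
    connectedComponentIn (complement (truncatedAffine n a a)) x = polytope (cellDigraph a x) := by
  obtain ⟨h0, hav⟩ := mem_complement_iff.1 hx
  apply Set.Subset.antisymm
  · intro y hy
    have hy' := connectedComponentIn_subset _ _ hy
    obtain ⟨hy0, hyav⟩ := mem_complement_iff.1 hy'
    refine ⟨hy0, fun i j => ?_⟩
    by_cases hij : i = j
    · simp [cellDigraph, hij]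
    simp only [cellDigraph, hij, if_false]
    rw [truncWeight_lt_coe_iff ha]
    intro k hk1 hk2 hk
    by_contra hlt
    have hcon : ((fun z : Fin n → ℝ => z i - z j) ''
        connectedComponentIn (complement (truncatedAffine n a a)) x).OrdConnected := by
      apply IsPreconnected.ordConnected
      apply isPreconnected_connectedComponentIn.image
      fun_prop
    have hkm := hcon.out ⟨y, hy, rfl⟩ ⟨x, mem_connectedComponentIn hx, rfl⟩
      (show (k : ℝ) ∈ Set.Icc _ _ from ⟨not_lt.1 hlt, Int.le_floor.1 hk⟩)
    obtain ⟨z, hz, hzk⟩ := hkm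
    exact (mem_complement_iff.1 (connectedComponentIn_subset _ _ hz)).2 i j hij k hk1 hk2 hzk
  · apply (convex_polytope _).isPreconnected.subset_connectedComponentIn
    · exact mem_polytope_cellDigraph ha h0 hav
    · intro y hy
      exact mem_complement_iff.2 ⟨hy.1,
        (eq_cellDigraph_of_mem_polytope ha (isValid_cellDigraph ha hav) hy).2⟩

/-! ### Acyclicity and nonempty polytopes -/

lemma isMAcyclic_of_mem_polytope {n : ℕ} {w : WeightedDigraph n} {x : Fin n → ℝ}
    (hx : x ∈ polytope w) : IsMAcyclic w := by
  rintro m c ⟨⟨-, hne⟩, hsum⟩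
  choose r hr using fun k => WithBot.ne_bot_iff_exists.1 (hne k)
  have hlt : ∀ k, r k < x (c k) - x (c (k + 1)) := by
    intro k
    have := hx.2 (c k) (c (k + 1))
    rw [← hr k] at this
    exact WithBot.coe_lt_coe.1 this
  have h1 : ∑ k, r k < ∑ k, (x (c k) - x (c (k + 1))) :=
    Finset.sum_lt_sum_of_nonempty Finset.univ_nonempty fun k _ => hlt k
  have h3 : ∑ k, x (c (k + 1)) = ∑ k, x (c k) :=
    Equiv.sum_comp (Equiv.addRight (1 : Fin (m + 1))) fun k => x (c k)
  rw [Finset.sum_sub_distrib, h3, sub_self] at h1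
  have h2 : ∑ k, w (c k) (c (k + 1)) = ((∑ k, r k : ℝ) : WithBot ℝ) := by
    rw [WithBot.coe_sum]
    exact Finset.sum_congr rfl fun k _ => (hr k).symm
  rw [h2] at hsum
  exact absurd (WithBot.coe_le_coe.1 hsum) (not_le.2 h1)

/-- An `m`-acyclic digraph with integer weights has a nonempty polytope. Increase every weight by
`1 / (n + 1)`; simple cycles then still have weight at most `0`, because their integer weight is
at most `-1`. So the supremum of the weights of the simple paths ending at a vertex is a potential
for the increased weights, and its negative satisfies the strict inequalities. -/
lemma polytope_nonempty_of_isMAcyclic {n : ℕ} {w : WeightedDigraph n}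
    (hint : ∀ i j, w i j ≠ ⊥ → ∃ k : ℤ, w i j = ((k : ℝ) : WithBot ℝ)) (hw : IsMAcyclic w) :
    (polytope w).Nonempty := by
  classical
  choose! g hg using hint
  set ε : ℝ := 1 / ((n : ℝ) + 1) with hε
  have hε0 : 0 < ε := by positivity
  set ω : Fin n → Fin n → ℝ := fun i j => (g i j : ℝ) + ε with hω
  let S : Fin n → Set ℝ := fun u => {s | ∃ (m : ℕ) (c : ℕ → Fin n), Set.InjOn c (Set.Iic m) ∧
    (∀ k < m, w (c k) (c (k + 1)) ≠ ⊥) ∧ c m = u ∧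
      s = ∑ k ∈ Finset.range m, ω (c k) (c (k + 1))}
  have hlen : ∀ (m : ℕ) (c : ℕ → Fin n), Set.InjOn c (Set.Iic m) → m + 1 ≤ n := by
    intro m c hc
    have h := Finset.card_le_card_of_injOn (s := Finset.range (m + 1)) (t := Finset.univ) c
      (fun _ _ => Finset.mem_coe.2 (Finset.mem_univ _))
      (hc.mono (fun k hk => by
        simp only [Finset.coe_range, Set.mem_Iio] at hk
        exact Nat.lt_succ_iff.1 hk))
    simpa using h
  have hne : ∀ u, (S u).Nonempty := by
    intro u
    refine ⟨0, 0, fun _ => u, ?_, by simp, rfl, by simp⟩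
    intro p hp q hq _
    simp only [Set.mem_Iic, nonpos_iff_eq_zero] at hp hq
    rw [hp, hq]
  have hbdd : ∀ u, BddAbove (S u) := by
    intro u
    set C : ℝ := ∑ i, ∑ j, |ω i j| with hC
    have hC0 : 0 ≤ C := by positivity
    have hωC : ∀ i j, ω i j ≤ C := by
      intro i j
      calc ω i j ≤ |ω i j| := le_abs_self _
        _ ≤ ∑ j, |ω i j| :=
          Finset.single_le_sum (f := fun j => |ω i j|) (fun _ _ => abs_nonneg _) (Finset.mem_univ j)
        _ ≤ C := Finset.single_le_sum (f := fun i => ∑ j, |ω i j|)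
          (fun _ _ => Finset.sum_nonneg fun _ _ => abs_nonneg _) (Finset.mem_univ i)
    refine ⟨n * C, ?_⟩
    rintro s ⟨m, c, hc, -, -, rfl⟩
    calc ∑ k ∈ Finset.range m, ω (c k) (c (k + 1)) ≤ ∑ _k ∈ Finset.range m, C :=
          Finset.sum_le_sum fun _ _ => hωC _ _
      _ = m * C := by simp
      _ ≤ n * C := by
        have : (m : ℝ) ≤ n := by exact_mod_cast (Nat.le_of_succ_le (hlen m c hc))
        gcongr
  have hmain : ∀ u v, w u v ≠ ⊥ → ∀ s ∈ S u, s + ω u v ≤ sSup (S v) := by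
    rintro u v huv s ⟨m, c, hc, hedge, rfl, rfl⟩
    by_cases hv : ∃ j ≤ m, c j = v
    · -- The path runs through `v`, and the edge closes a cycle, which may be cut off.
      obtain ⟨j, hj, rfl⟩ := hv
      obtain ⟨l, rfl⟩ := Nat.exists_eq_add_of_le hj
      rw [Finset.sum_range_add]
      have hpre : ∑ k ∈ Finset.range j, ω (c k) (c (k + 1)) ≤ sSup (S (c j)) :=
        le_csSup (hbdd _) ⟨j, c, hc.mono (fun k hk => le_trans hk hj),
          fun k hk => hedge k (by omega), rfl, rfl⟩
      suffices hcyc : ∑ k ∈ Finset.range l, ω (c (j + k)) (c (j + k + 1)) +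
          ω (c (j + l)) (c j) ≤ 0 by linarith
      let d : Fin (l + 1) → Fin n := fun k => c (j + k)
      have hd : ∀ f : Fin n → Fin n → ℝ, ∑ k, f (d k) (d (k + 1)) =
          ∑ k ∈ Finset.range l, f (c (j + k)) (c (j + k + 1)) + f (c (j + l)) (c j) := by
        intro f
        rw [Fin.sum_univ_castSucc, Finset.sum_range]
        congr 1
        · refine Finset.sum_congr rfl fun k _ => ?_
          simp only [Fin.coeSucc_eq_succ, d, Fin.val_castSucc, Fin.val_succ, add_assoc]
        · simp [d]
      have hdedge : ∀ k, w (d k) (d (k + 1)) ≠ ⊥ := by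
        intro k
        induction k using Fin.lastCases with
        | last => simpa [d] using huv
        | cast k =>
          have := hedge (j + k) (by omega)
          simpa only [Fin.coeSucc_eq_succ, d, Fin.val_castSucc, Fin.val_succ, add_assoc] using this
      have hdinj : Function.Injective d := by
        intro p q hpq
        have := hc (by simp only [Set.mem_Iic]; omega) (by simp only [Set.mem_Iic]; omega) hpq
        exact Fin.ext (by omega)
      have hneg : ¬ 0 ≤ ∑ k, w (d k) (d (k + 1)) := fun h => hw l d ⟨⟨hdinj, hdedge⟩, h⟩
      have hcoe : ∑ k, w (d k) (d (k + 1)) =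
          (((∑ k, g (d k) (d (k + 1)) : ℤ) : ℝ) : WithBot ℝ) := by
        rw [Int.cast_sum, WithBot.coe_sum]
        exact Finset.sum_congr rfl fun k _ => hg _ _ (hdedge k)
      rw [hcoe] at hneg
      have hneg' : ∑ k, g (d k) (d (k + 1)) ≤ -1 := by
        by_contra hcon
        apply hneg
        have h0 : (0 : ℤ) ≤ ∑ k, g (d k) (d (k + 1)) := by omega
        exact WithBot.coe_le_coe.2 (by exact_mod_cast h0)
      have hneg'' : ∑ k, (g (d k) (d (k + 1)) : ℝ) ≤ -1 := by exact_mod_cast hneg'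
      rw [← hd ω]
      simp only [hω, Finset.sum_add_distrib, Finset.sum_const, Finset.card_univ, Fintype.card_fin,
        nsmul_eq_mul]
      have hl : ((l + 1 : ℕ) : ℝ) ≤ n := by
        have := hlen _ _ hc
        exact_mod_cast (by omega : l + 1 ≤ n)
      have hle : ((l + 1 : ℕ) : ℝ) * ε ≤ 1 := by
        rw [hε, mul_one_div, div_le_one (by positivity)]
        linarith
      linarith
    · push Not at hv
      refine le_csSup (hbdd _) ⟨m + 1, Function.update c (m + 1) v, ?_, ?_, by simp, ?_⟩
      · intro p hp q hq hpq
        simp only [Set.mem_Iic] at hp hq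
        rcases Nat.lt_or_ge m p with h1 | h1 <;> rcases Nat.lt_or_ge m q with h2 | h2
        · omega
        · have hp' : p = m + 1 := by omega
          subst hp'
          rw [Function.update_self, Function.update_of_ne (by omega)] at hpq
          exact absurd hpq.symm (hv q h2)
        · have hq' : q = m + 1 := by omega
          subst hq'
          rw [Function.update_self, Function.update_of_ne (by omega)] at hpq
          exact absurd hpq (hv p h1)
        · rw [Function.update_of_ne (by omega), Function.update_of_ne (by omega)] at hpq
          exact hc h1 h2 hpq
      · intro k hk
        rw [Function.update_of_ne (by omega)]
        rcases Nat.lt_or_ge k m with h1 | h1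
        · rw [Function.update_of_ne (by omega)]
          exact hedge k h1
        · have : k = m := by omega
          subst this
          rwa [Function.update_self]
      · rw [Finset.sum_range_succ, Function.update_self, Function.update_of_ne (by omega)]
        congr 1
        refine Finset.sum_congr rfl fun k hk => ?_
        rw [Finset.mem_range] at hk
        rw [Function.update_of_ne (by omega), Function.update_of_ne (by omega)]
  let p : Fin n → ℝ := fun u => sSup (S u)
  have hp : ∀ u v, w u v ≠ ⊥ → p u + ω u v ≤ p v := by
    intro u v huv
    have : p u ≤ p v - ω u v := csSup_le (hne u) fun s hs => by
      have := hmain u v huv s hs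
      simp only [p]; linarith
    linarith
  -- Shifting by the mean makes the coordinates add up to zero.
  refine ⟨fun u => (∑ v, p v) / n - p u, ?_, fun i j => ?_⟩
  · rcases Nat.eq_zero_or_pos n with rfl | hn
    · simp
    · have : (n : ℝ) ≠ 0 := by positivity
      rw [Finset.sum_sub_distrib, Finset.sum_const, Finset.card_univ, Fintype.card_fin,
        nsmul_eq_mul]
      field_simp
      ring
  · by_cases hij : w i j = ⊥
    · rw [hij]; exact WithBot.bot_lt_coe _
    · rw [hg i j hij, WithBot.coe_lt_coe]
      have := hp i j hij
      simp only [hω] at this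
      linarith

/-! ### Level sequences -/

/-- The integer part of `y v - y u` when `y v` has integer part `ℓ v` and the fractional parts of
`y` are ordered as the positions `σ`. -/
def gap {n : ℕ} (σ : Equiv.Perm (Fin n)) (ℓ : Fin n → ℤ) (u v : Fin n) : ℤ :=
  ℓ v - ℓ u - if σ v < σ u then 1 else 0

/-- The sequences of levels of the up steps of `a`-Catalan paths: they start at `0`, remain
nonnegative, and increase by at most `a - 1` from one up step to the next. -/
structure IsLevelSequence {n : ℕ} (a : ℕ) (L : Fin n → ℤ) : Prop where
  nonneg : ∀ i, 0 ≤ L i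
  zero : ∀ i : Fin n, (i : ℕ) = 0 → L i = 0
  step : ∀ i j : Fin n, (j : ℕ) = i + 1 → L j ≤ L i + a - 1

lemma gap_of_lt {n : ℕ} {σ : Equiv.Perm (Fin n)} {u v : Fin n} (h : σ u < σ v) (ℓ : Fin n → ℤ) :
    gap σ ℓ u v = ℓ v - ℓ u := by
  rw [gap, if_neg (not_lt.2 h.le), sub_zero]

lemma gap_of_gt {n : ℕ} {σ : Equiv.Perm (Fin n)} {u v : Fin n} (h : σ v < σ u) (ℓ : Fin n → ℤ) :
    gap σ ℓ u v = ℓ v - ℓ u - 1 := by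
  rw [gap, if_pos h]

/-- Since a level sequence starts at `0` and climbs slowly, every height it can exceed lies
shortly above one of its earlier terms. -/
lemma IsLevelSequence.exists_le {n a : ℕ} {L : Fin n → ℤ} (hL : IsLevelSequence a L) {c h : ℤ}
    (hc : (a : ℤ) - 2 ≤ c) (h0 : 0 ≤ h) (m : ℕ) (hm : m < n) (hh : h ≤ L ⟨m, hm⟩ + c) :
    ∃ p : Fin n, (p : ℕ) ≤ m ∧ L p ≤ h ∧ h ≤ L p + c := by
  induction m with
  | zero => exact ⟨⟨0, hm⟩, le_rfl, by rw [hL.zero _ rfl]; exact h0, hh⟩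
  | succ m ih =>
    by_cases hle : L ⟨m + 1, hm⟩ ≤ h
    · exact ⟨_, le_rfl, hle, hh⟩
    · have := hL.step ⟨m, by omega⟩ ⟨m + 1, hm⟩ rfl
      obtain ⟨p, hp, h1⟩ := ih (by omega) (by omega)
      exact ⟨p, by omega, h1⟩

/-! ### A digraph determines the labeled path -/

section Uniqueness

variable {n a : ℕ} {σ τ : Equiv.Perm (Fin n)} {L M : Fin n → ℤ}

/-- Two labeled level sequences are indistinguishable by the hyperplanes. -/
def SameCell (a : ℕ) (σ τ : Equiv.Perm (Fin n)) (L M : Fin n → ℤ) : Prop :=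
  ∀ u v, u ≠ v → ∀ k : ℤ, 1 - (a : ℤ) ≤ k → k ≤ (a : ℤ) - 1 →
    (k ≤ gap σ (L ∘ σ) u v ↔ k ≤ gap τ (M ∘ τ) u v)

/-- Two labeled level sequences agree in their first `i` positions. -/
def AgreeBelow (i : ℕ) (σ τ : Equiv.Perm (Fin n)) (L M : Fin n → ℤ) : Prop :=
  ∀ p : Fin n, (p : ℕ) < i → σ.symm p = τ.symm p ∧ L p = M p

lemma SameCell.symm (h : SameCell a σ τ L M) : SameCell a τ σ M L :=
  fun u v huv k h1 h2 => (h u v huv k h1 h2).symm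

lemma AgreeBelow.symm {i : ℕ} (h : AgreeBelow i σ τ L M) : AgreeBelow i τ σ M L :=
  fun p hp => ⟨(h p hp).1.symm, (h p hp).2.symm⟩

lemma AgreeBelow.le_of_le {i : ℕ} (h : AgreeBelow i σ τ L M) {z : Fin n} (hz : i ≤ σ z) :
    i ≤ τ z := by
  by_contra hlt
  have := (h (τ z) (by omega)).1
  rw [Equiv.symm_apply_apply, Equiv.symm_apply_eq] at this
  rw [← this] at hz
  omega

/-- A vertex beyond the common prefix whose level is at most `c ≤ a - 1` above that of the last
common vertex is compared with a vertex of the prefix. The hyperplanes bound its level in the other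
sequence from below by its level in this one, and also from above if `c = a - 2`, when the
difference of the two levels stays below the largest constant `a - 1`. -/
lemma AgreeBelow.exists_compare (hL : IsLevelSequence a L) (hS : SameCell a σ τ L M) {m : ℕ}
    (hA : AgreeBelow (m + 1) σ τ L M) (hm : m < n) {c : ℤ} (hc1 : (a : ℤ) - 2 ≤ c)
    (hc2 : c ≤ (a : ℤ) - 1) {z : Fin n} (hz : m + 1 ≤ (σ z : ℕ))
    (hle : L (σ z) ≤ L ⟨m, hm⟩ + c) :
    L (σ z) ≤ M (τ z) ∧ (c = (a : ℤ) - 2 → M (τ z) = L (σ z)) := by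
  obtain ⟨p, hp, h1, h2⟩ := hL.exists_le hc1 (hL.nonneg (σ z)) m hm hle
  obtain ⟨hp1, hp2⟩ := hA p (by omega)
  set u := σ.symm p with hu
  have hσu : σ u = p := by simp [hu]
  have hτu : τ u = p := by rw [hp1]; simp
  have hzτ := hA.le_of_le hz
  have hne : u ≠ z := by
    intro h
    rw [← h, hσu] at hz
    omega
  have hS' := hS u z hne
  rw [gap_of_lt (by rw [hσu]; exact Fin.lt_def.2 (by omega)),
    gap_of_lt (by rw [hτu]; exact Fin.lt_def.2 (by omega))] at hS'
  simp only [Function.comp_apply, hσu, hτu, ← hp2] at hS'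
  constructor
  · have := hS' (L (σ z) - L p) (by omega) (by omega)
    omega
  · intro hc
    have e1 := hS' (L (σ z) - L p) (by omega) (by omega)
    have e2 := hS' (L (σ z) - L p + 1) (by omega) (by omega)
    omega

lemma AgreeBelow.next_level_le (hL : IsLevelSequence a L) (hM : IsLevelSequence a M)
    (hS : SameCell a σ τ L M) {i : ℕ} (hA : AgreeBelow i σ τ L M) {z : Fin n}
    (hz : (σ z : ℕ) = i) : L (σ z) ≤ M (τ z) := by
  cases i with
  | zero => rw [hL.zero _ hz]; exact hM.nonneg _
  | succ m =>
    have hm : m < n := by omega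
    have := hL.step ⟨m, hm⟩ (σ z) hz
    exact (hA.exists_compare hL hS hm (c := (a : ℤ) - 1) (by omega) le_rfl hz.ge (by omega)).1

/-- After a common prefix both sequences continue with the same vertex. If the first one goes on
at a lower level than the second, then its vertices up to the one chosen by the second, `v'`,
have to lie at least `a` below the level of `v'`, and from there `v'` cannot be reached. -/
lemma AgreeBelow.next_eq (hL : IsLevelSequence a L) (hM : IsLevelSequence a M)
    (ha : 1 ≤ a) (hS : SameCell a σ τ L M) {i : ℕ} (hi : i < n) (hA : AgreeBelow i σ τ L M)
    (hle : L ⟨i, hi⟩ ≤ M ⟨i, hi⟩) : σ.symm ⟨i, hi⟩ = τ.symm ⟨i, hi⟩ := by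
  by_contra hne
  set v := σ.symm ⟨i, hi⟩ with hv
  set v' := τ.symm ⟨i, hi⟩ with hv'
  have hσv : σ v = ⟨i, hi⟩ := by simp [hv]
  have hτv' : τ v' = ⟨i, hi⟩ := by simp [hv']
  have h1 : i < (τ v : ℕ) := by
    refine lt_of_le_of_ne (hA.le_of_le (by rw [hσv])) fun h => hne ?_
    rw [hv', Equiv.eq_symm_apply]
    exact Fin.ext h.symm
  have h2 : i < (σ v' : ℕ) := by
    refine lt_of_le_of_ne (hA.symm.le_of_le (by rw [hτv'])) fun h => hne ?_
    rw [hv, Equiv.symm_apply_eq]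
    exact Fin.ext h
  have h3 := hA.next_level_le hL hM hS (z := v) (by rw [hσv])
  have h4 := hA.symm.next_level_le hM hL hS.symm (z := v') (by rw [hτv'])
  rw [hσv] at h3
  rw [hτv'] at h4
  rcases hle.eq_or_lt with heq | hlt
  · have := hS v v' hne 0 (by omega) (by omega)
    rw [gap_of_lt (by rw [hσv]; exact Fin.lt_def.2 h2),
      gap_of_gt (by rw [hτv']; exact Fin.lt_def.2 h1)] at this
    simp only [Function.comp_apply, hσv, hτv'] at this
    omega
  · obtain ⟨m, rfl⟩ : ∃ m, i = m + 1 := by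
      cases i with
      | zero => rw [hL.zero _ rfl, hM.zero _ rfl] at hlt; exact absurd hlt (lt_irrefl _)
      | succ m => exact ⟨m, rfl⟩
    have hm : m < n := by omega
    have hstep := hM.step ⟨m, hm⟩ ⟨m + 1, hi⟩ rfl
    rw [← (hA ⟨m, hm⟩ (Nat.lt_succ_self m)).2] at hstep
    have drop : ∀ p (hp : p < n), m + 1 ≤ p → p < σ v' → L ⟨p, hp⟩ < M ⟨m + 1, hi⟩ →
        L ⟨p, hp⟩ ≤ M ⟨m + 1, hi⟩ - a := by
      intro p hp hp1 hp2 hp3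
      set z := σ.symm ⟨p, hp⟩ with hz
      have hσz : σ z = ⟨p, hp⟩ := by simp [hz]
      have hzv' : z ≠ v' := by
        intro h
        rw [← h, hσz] at hp2
        exact lt_irrefl _ hp2
      have hτz : m + 1 < (τ z : ℕ) := by
        refine lt_of_le_of_ne (hA.le_of_le (by rw [hσz]; exact hp1)) fun h => hzv' ?_
        rw [hv', Equiv.eq_symm_apply]
        exact Fin.ext h.symm
      have hzl := (hA.exists_compare hL hS hm (z := z) (c := (a : ℤ) - 2) le_rfl (by omega)
        (by rw [hσz]; exact hp1) (by rw [hσz]; omega)).2 rfl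
      rw [hσz] at hzl
      have hcmp := hS z v' hzv' (M ⟨m + 1, hi⟩ - L ⟨p, hp⟩)
      rw [gap_of_lt (by rw [hσz]; exact Fin.lt_def.2 hp2),
        gap_of_gt (by rw [hτv']; exact Fin.lt_def.2 hτz)] at hcmp
      simp only [Function.comp_apply, hσz, hτv', hzl] at hcmp
      by_contra hcon
      have := hcmp (by omega) (by omega)
      omega
    have low : ∀ p, m + 1 ≤ p → ∀ hp : p < n, p < σ v' → L ⟨p, hp⟩ ≤ M ⟨m + 1, hi⟩ - a := by
      intro p hp1
      induction p, hp1 using Nat.le_induction with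
      | base => exact fun hp hp2 => drop _ hp le_rfl hp2 hlt
      | succ p hp1 ih =>
        intro hp hp2
        have e1 := ih (by omega) (by omega)
        have e2 := hL.step ⟨p, by omega⟩ ⟨p + 1, hp⟩ rfl
        exact drop _ hp (by omega) hp2 (by omega)
    have e1 := low ((σ v' : ℕ) - 1) (by omega) (by omega) (by omega)
    have e2 := hL.step ⟨(σ v' : ℕ) - 1, by omega⟩ (σ v') (by simp only; omega)
    omega

/-- A labeled level sequence is determined by its digraph. -/
theorem SameCell.eq (ha : 1 ≤ a) (hL : IsLevelSequence a L) (hM : IsLevelSequence a M)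
    (hS : SameCell a σ τ L M) : σ = τ ∧ L = M := by
  have key : ∀ i, AgreeBelow i σ τ L M := by
    intro i
    induction i with
    | zero => exact fun p hp => absurd hp (Nat.not_lt_zero _)
    | succ i ih =>
      intro p hp
      rcases Nat.lt_succ_iff_lt_or_eq.1 hp with h | h
      · exact ih p h
      subst h
      have hv : σ.symm p = τ.symm p := by
        rcases le_total (L p) (M p) with hle | hle
        · exact ih.next_eq hL hM ha hS p.2 hle
        · exact (ih.symm.next_eq hM hL ha hS.symm p.2 hle).symm
      refine ⟨hv, le_antisymm ?_ ?_⟩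
      · have := ih.next_level_le hL hM hS (z := σ.symm p) (by simp)
        rw [hv, Equiv.apply_symm_apply, ← hv, Equiv.apply_symm_apply] at this
        exact this
      · have := ih.symm.next_level_le hM hL hS.symm (z := σ.symm p) (by rw [hv]; simp)
        rw [Equiv.apply_symm_apply, hv, Equiv.apply_symm_apply] at this
        exact this
  constructor
  · have : σ.symm = τ.symm := Equiv.ext fun p => (key n p p.2).1
    exact Equiv.symm_bijective.1 this
  · funext p
    exact (key n p p.2).2

end Uniqueness

/-! ### Lattice paths and their level sequences -/

section Paths

variable {a n : ℕ}

lemma count_true_take (s : List Bool) (k : ℕ) :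
    (s.take k).count true = Nat.count (fun j => s[j]? = some true) k := by
  induction k with
  | zero => simp
  | succ k ih =>
    rw [List.take_add_one, List.count_append, ih, Nat.count_succ]
    rcases s[k]? with _ | _ | _ <;> simp

lemma height_eq (a : ℕ) (s : List Bool) : height a s = a * s.count true - s.length := by
  induction s with
  | nil => simp [height]
  | cons b s ih =>
    have : height a (b :: s) = (if b then (a : ℤ) - 1 else -1) + height a s := by simp [height]
    rw [this, ih]
    cases b
    · simp; ring
    · simp; ring

lemma height_take (a : ℕ) (s : List Bool) {k : ℕ} (hk : k ≤ s.length) :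
    height a (s.take k) = a * Nat.count (fun j => s[j]? = some true) k - k := by
  rw [height_eq, count_true_take, List.length_take, min_eq_left hk]

lemma CatalanPath.length_steps (Λ : CatalanPath a n) : (Λ.steps.length : ℤ) = a * n := by
  have h1 := Λ.count_down
  have h2 := Λ.count_up
  have h3 : Λ.steps.count true + Λ.steps.count false = Λ.steps.length :=
    List.count_true_add_count_false Λ.steps
  rw [← h3]
  push_cast
  rw [h1, h2]
  ring

/-- The index of an up step in the path. -/
noncomputable def CatalanPath.upIndex (Λ : CatalanPath a n) (i : ℕ) : ℕ :=
  Nat.nth (fun k => Λ.steps[k]? = some true) i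

lemma CatalanPath.count_length (Λ : CatalanPath a n) :
    Nat.count (fun k => Λ.steps[k]? = some true) Λ.steps.length = n := by
  rw [← count_true_take, List.take_length, Λ.count_up]

lemma CatalanPath.lt_card (Λ : CatalanPath a n) {i : ℕ} (hi : i < n)
    (hf : (Set.ofPred fun k : ℕ => Λ.steps[k]? = some true).Finite) : i < hf.toFinset.card :=
  lt_of_lt_of_le (by rw [Λ.count_length]; exact hi) (Nat.count_le_card hf Λ.steps.length)

lemma CatalanPath.upLevel_eq (Λ : CatalanPath a n) (i : Fin n) :
    Λ.upLevel i = a * i - Λ.upIndex i := by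
  have hlt : Λ.upIndex i < Λ.steps.length :=
    Nat.nth_lt_of_lt_count (by rw [Λ.count_length]; exact i.2)
  have hc : Nat.count (fun k => Λ.steps[k]? = some true) (Λ.upIndex i) = i :=
    Nat.count_nth fun hf => Λ.lt_card i.2 hf
  have := height_take a Λ.steps hlt.le
  rw [hc] at this
  exact this

lemma CatalanPath.upIndex_lt (Λ : CatalanPath a n) {i j : ℕ} (hij : i < j) (hj : j < n) :
    Λ.upIndex i < Λ.upIndex j :=
  Nat.nth_lt_nth' hij fun hf => Λ.lt_card hj hf

lemma CatalanPath.isLevelSequence (Λ : CatalanPath a n) : IsLevelSequence a Λ.upLevel where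
  nonneg i := Λ.nonneg _
  zero i hi := by
    have h1 : 0 ≤ Λ.upLevel i := Λ.nonneg _
    have h2 := Λ.upLevel_eq i
    rw [hi] at h2
    simp only [Nat.cast_zero, mul_zero] at h2
    omega
  step i j hij := by
    rw [Λ.upLevel_eq, Λ.upLevel_eq, hij]
    have := Λ.upIndex_lt (Nat.lt_add_one i) (by rw [← hij]; exact j.2)
    push_cast
    rw [mul_add, mul_one]
    omega

lemma CatalanPath.getElem?_eq_some_true_iff (Λ : CatalanPath a n) (k : ℕ) :
    Λ.steps[k]? = some true ↔ ∃ i : Fin n, Λ.upIndex i = k := by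
  constructor
  · intro h
    have hk : k < Λ.steps.length := by
      by_contra hk
      rw [List.getElem?_eq_none (not_lt.1 hk)] at h
      exact absurd h (by simp)
    have hlt : Nat.count (fun k => Λ.steps[k]? = some true) k < n := by
      conv_rhs => rw [← Λ.count_length]
      exact Nat.count_strict_mono h hk
    exact ⟨⟨_, hlt⟩, Nat.nth_count (p := fun k => Λ.steps[k]? = some true) h⟩
  · rintro ⟨i, rfl⟩
    exact Nat.nth_mem (p := fun k => Λ.steps[k]? = some true) i fun hf => Λ.lt_card i.2 hf

lemma CatalanPath.upLevel_injective :
    Function.Injective (CatalanPath.upLevel : CatalanPath a n → Fin n → ℤ) := by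
  intro Λ Λ' h
  have hidx : ∀ i : Fin n, Λ.upIndex i = Λ'.upIndex i := by
    intro i
    have h1 := congrFun h i
    rw [Λ.upLevel_eq, Λ'.upLevel_eq] at h1
    omega
  have hlen : Λ.steps.length = Λ'.steps.length := by
    have h1 := Λ.length_steps
    have h2 := Λ'.length_steps
    omega
  have hsteps : Λ.steps = Λ'.steps := by
    apply List.ext_getElem hlen
    intro k hk hk'
    have h1 := Λ.getElem?_eq_some_true_iff k
    have h2 := Λ'.getElem?_eq_some_true_iff k
    simp only [hidx] at h1
    have h3 := h1.trans h2.symm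
    rw [List.getElem?_eq_getElem hk, List.getElem?_eq_getElem hk', Option.some_inj,
      Option.some_inj] at h3
    exact Bool.eq_iff_iff.2 h3
  cases Λ
  cases Λ'
  cases hsteps
  rfl

lemma IsLevelSequence.le_add {L : Fin n → ℤ} (hL : IsLevelSequence a L) (i : Fin n) (d : ℕ)
    (hd : i + d < n) : L ⟨i + d, hd⟩ ≤ L i + (a - 1) * d := by
  induction d with
  | zero => simp
  | succ d ih =>
    have h1 := ih (by omega)
    have h2 := hL.step ⟨i + d, by omega⟩ ⟨i + (d + 1), hd⟩ (by simp only; omega)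
    push_cast
    linarith

/-- The path with given level sequence `L` has its up step number `i` at index `a i - L i`. -/
lemma IsLevelSequence.exists_index {L : Fin n → ℤ} (hL : IsLevelSequence a L) :
    ∃ t : Fin n → ℕ, StrictMono t ∧ ∀ i, (t i : ℤ) = a * i - L i := by
  have h : ∀ i : Fin n, ∃ t : ℕ, (t : ℤ) = a * i - L i := by
    intro i
    refine ⟨((a : ℤ) * i - L i).toNat, Int.toNat_of_nonneg ?_⟩
    have h1 := hL.le_add ⟨0, i.pos⟩ i (by simp)
    simp only [zero_add, Fin.eta] at h1
    rw [hL.zero ⟨0, i.pos⟩ rfl] at h1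
    have : (0 : ℤ) ≤ (i : ℕ) := by positivity
    linarith
  choose t ht using h
  refine ⟨t, ?_, ht⟩
  intro i j hij
  obtain ⟨d, hd⟩ := Nat.exists_eq_add_of_lt (Fin.lt_def.1 hij)
  have hj : j = ⟨i + (d + 1), by omega⟩ := Fin.ext (by simp only; omega)
  have h1 := hL.le_add i (d + 1) (by omega)
  have h2 := ht i
  have h3 := ht j
  rw [← hj] at h1
  have hd' : ((j : ℕ) : ℤ) = i + d + 1 := by exact_mod_cast hd
  rw [hd'] at h3
  push_cast at h1
  have : (t i : ℤ) < t j := by linarith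
  exact_mod_cast this

/-- Every level sequence is the sequence of up step levels of a path. -/
lemma IsLevelSequence.exists_path (ha : 1 ≤ a) {L : Fin n → ℤ} (hL : IsLevelSequence a L) :
    ∃ Λ : CatalanPath a n, Λ.upLevel = L := by
  classical
  obtain ⟨t, htm, ht⟩ := hL.exists_index
  have htlt : ∀ i, t i < a * n := by
    intro i
    have h1 : t i ≤ a * i := by
      have := ht i
      have := hL.nonneg i
      have : (t i : ℤ) ≤ ((a * i : ℕ) : ℤ) := by push_cast; omega
      exact_mod_cast this
    have : a * i < a * n := Nat.mul_lt_mul_of_pos_left i.2 (by omega)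
    omega
  set s : List Bool := List.ofFn fun k : Fin (a * n) => decide (∃ i, t i = k) with hs
  have hlen : s.length = a * n := by simp [hs]
  have hmem : ∀ k, s[k]? = some true ↔ ∃ i, t i = k := by
    intro k
    rw [hs, List.getElem?_ofFn]
    split_ifs with hk
    · simp
    · simp only [false_iff]
      rintro ⟨i, rfl⟩
      exact hk (htlt i)
  have hcount : ∀ k, Nat.count (fun j => s[j]? = some true) k =
      (Finset.univ.filter fun i => t i < k).card := by
    intro k
    rw [Nat.count_eq_card_filter_range, ← Finset.card_image_of_injective _ htm.injective]
    congr 1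
    ext j
    simp only [Finset.mem_filter, Finset.mem_range, Finset.mem_image, Finset.mem_univ, true_and,
      hmem]
    constructor
    · rintro ⟨h1, i, rfl⟩
      exact ⟨i, h1, rfl⟩
    · rintro ⟨i, h1, rfl⟩
      exact ⟨h1, i, rfl⟩
  have hall : (Finset.univ.filter fun i => t i < a * n).card = n := by
    rw [Finset.filter_true_of_mem fun i _ => htlt i, Finset.card_univ, Fintype.card_fin]
  have hup : s.count true = n := by
    have := count_true_take s s.length
    rwa [List.take_length, hcount, hlen, hall] at this
  have hnonneg : ∀ k, k ≤ s.length → 0 ≤ height a (s.take k) := by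
    intro k hk
    rw [height_take a s hk, hcount]
    set c := (Finset.univ.filter fun i => t i < k).card with hc
    suffices h : k ≤ a * c by
      have : (k : ℤ) ≤ a * c := by exact_mod_cast h
      linarith
    have hcn : c ≤ n := by
      rw [hc]
      exact (Finset.card_le_univ _).trans_eq (Fintype.card_fin n)
    rcases hcn.eq_or_lt with h | h
    · rw [h, ← hlen]; exact hk
    · -- At most `c` up steps precede step `k`, so the up step number `c` does not.
      have h1 : k ≤ t ⟨c, h⟩ := by
        by_contra hlt
        have hsub : Finset.Iic (⟨c, h⟩ : Fin n) ⊆ Finset.univ.filter fun i => t i < k := by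
          intro i hi
          rw [Finset.mem_Iic] at hi
          rw [Finset.mem_filter]
          exact ⟨Finset.mem_univ _, lt_of_le_of_lt (htm.monotone hi) (not_le.1 hlt)⟩
        have := Finset.card_le_card hsub
        rw [Fin.card_Iic, ← hc] at this
        simp only at this
        omega
      have h2 := ht ⟨c, h⟩
      have h3 := hL.nonneg ⟨c, h⟩
      have : (k : ℤ) ≤ ((a * c : ℕ) : ℤ) := by
        push_cast
        simp only at h2
        have : (k : ℤ) ≤ t ⟨c, h⟩ := by exact_mod_cast h1
        linarith
      exact_mod_cast this
  let Λ : CatalanPath a n :=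
    { steps := s
      count_up := hup
      count_down := by
        have h3 : s.count true + s.count false = s.length := List.count_true_add_count_false s
        rw [hup, hlen] at h3
        have : (n : ℤ) + s.count false = a * n := by exact_mod_cast h3
        linarith
      nonneg := fun k => by
        rcases le_total k s.length with hk | hk
        · exact hnonneg k hk
        · rw [List.take_of_length_le hk, ← List.take_length (l := s)]
          exact hnonneg _ le_rfl }
  refine ⟨Λ, funext fun i => ?_⟩
  have hidx : Λ.upIndex i = t i := by
    have hc : Nat.count (fun j => s[j]? = some true) (t i) = i := by
      rw [hcount]
      have : (Finset.univ.filter fun j => t j < t i) = Finset.Iio i := by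
        ext j
        simp [htm.lt_iff_lt]
      rw [this, Fin.card_Iio]
    have := Nat.nth_count (p := fun j => s[j]? = some true) ((hmem (t i)).2 ⟨i, rfl⟩)
    rw [hc] at this
    exact this
  rw [Λ.upLevel_eq, hidx, ht]
  ring

end Paths

/-! ### Normalizing a point to a labeled level sequence -/

section Normalization

variable {n a : ℕ}

/-- Moving the vertex in position `0` to the last position while decreasing its level by `1` keeps
all gaps. -/
lemma gap_rotate {m : ℕ} (σ : Equiv.Perm (Fin (m + 1))) (ℓ : Fin (m + 1) → ℤ)
    {u v : Fin (m + 1)} (huv : u ≠ v) :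
    gap (σ.trans (finRotate (m + 1)).symm) (fun z => ℓ z - if σ z = 0 then 1 else 0) u v =
      gap σ ℓ u v := by
  have hrot : ∀ p : Fin (m + 1),
      (((finRotate (m + 1)).symm p : Fin (m + 1)) : ℕ) = if p = 0 then m else (p : ℕ) - 1 := by
    intro p
    obtain ⟨q, rfl⟩ := (finRotate (m + 1)).surjective p
    rw [Equiv.symm_apply_apply]
    have hq : ((finRotate (m + 1) q : Fin (m + 1)) : ℕ) = if q = Fin.last m then 0 else (q : ℕ) + 1 :=
      coe_finRotate q
    by_cases h : q = Fin.last m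
    · subst h
      rw [if_pos rfl] at hq
      rw [if_pos (Fin.ext hq)]
      rfl
    · rw [if_neg h] at hq
      rw [if_neg (fun h0 => by rw [h0] at hq; simp at hq), hq]
      rfl
  have hne : (σ u : ℕ) ≠ σ v := fun h => huv (σ.injective (Fin.ext h))
  simp only [gap, Equiv.trans_apply, Fin.lt_def, hrot, Fin.ext_iff, Fin.val_zero]
  have := (σ u).2
  have := (σ v).2
  split_ifs <;> omega

/-- Exchanging the vertices in the consecutive positions `i` and `j = i + 1` does not change the
digraph if the second one lies at least `a` higher. -/
lemma truncWeight_gap_swap (ha : 1 ≤ a) (σ : Equiv.Perm (Fin n)) (ℓ : Fin n → ℤ) {i j : Fin n}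
    (hij : (j : ℕ) = i + 1) (hℓ : ℓ (σ.symm i) + a ≤ ℓ (σ.symm j)) (u v : Fin n) :
    truncWeight a (gap (σ.trans (Equiv.swap i j)) ℓ u v) = truncWeight a (gap σ ℓ u v) := by
  by_cases h1 : σ u = i ∧ σ v = j
  · obtain ⟨h1, h2⟩ := h1
    rw [← h1, ← h2, Equiv.symm_apply_apply, Equiv.symm_apply_apply] at hℓ
    apply truncWeight_congr ha
    rw [gap_of_lt (σ := σ) (by rw [h1, h2, Fin.lt_def]; omega), gap_of_gt]
    · omega
    · rw [Equiv.trans_apply, Equiv.trans_apply, h1, h2, Equiv.swap_apply_left,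
        Equiv.swap_apply_right, Fin.lt_def]
      omega
  by_cases h2 : σ u = j ∧ σ v = i
  · obtain ⟨h2, h3⟩ := h2
    rw [← h2, ← h3, Equiv.symm_apply_apply, Equiv.symm_apply_apply] at hℓ
    apply truncWeight_congr ha
    rw [gap_of_gt (σ := σ) (by rw [h3, h2, Fin.lt_def]; omega), gap_of_lt]
    · omega
    · rw [Equiv.trans_apply, Equiv.trans_apply, h2, h3, Equiv.swap_apply_left,
        Equiv.swap_apply_right, Fin.lt_def]
      omega
  · congr 1
    have key : (σ.trans (Equiv.swap i j) v < σ.trans (Equiv.swap i j) u) ↔ σ v < σ u := by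
      simp only [Equiv.trans_apply, Equiv.swap_apply_def, Fin.lt_def]
      simp only [Fin.ext_iff] at h1 h2 ⊢
      split_ifs <;> omega
    simp only [gap, key]

lemma sum_mul_swap_lt (f : Fin n → ℕ) {i j : Fin n} (hij : (j : ℕ) = i + 1) (hf : f i < f j) :
    ∑ p, f p * (Equiv.swap i j p : ℕ) < ∑ p, f p * (p : ℕ) := by
  have hne : j ≠ i := fun h => by rw [h] at hij; omega
  have split : ∀ g : Fin n → ℕ,
      ∑ p, g p = g i + (g j + ∑ p ∈ (Finset.univ.erase i).erase j, g p) := by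
    intro g
    rw [Finset.add_sum_erase _ _ (Finset.mem_erase.2 ⟨hne, Finset.mem_univ j⟩),
      Finset.add_sum_erase _ _ (Finset.mem_univ i)]
  rw [split, split (fun p => f p * (p : ℕ))]
  have hrest : ∑ p ∈ (Finset.univ.erase i).erase j, f p * (Equiv.swap i j p : ℕ) =
      ∑ p ∈ (Finset.univ.erase i).erase j, f p * (p : ℕ) := by
    refine Finset.sum_congr rfl fun p hp => ?_
    simp only [Finset.mem_erase] at hp
    rw [Equiv.swap_apply_of_ne_of_ne hp.2.1 hp.1]
  rw [hrest, Equiv.swap_apply_left, Equiv.swap_apply_right, hij]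
  nlinarith

/-- Integer parts as levels, and positions sorted by fractional parts, give back the digraph of a
point. Equal fractional parts may be ordered arbitrarily, because the corresponding difference is
then an integer of absolute value at least `a`. -/
lemma exists_gap_eq_floor (ha : 1 ≤ a) {x : Fin n → ℝ} (hx : AvoidsHyperplanes a x) :
    ∃ (σ : Equiv.Perm (Fin n)) (ℓ : Fin n → ℕ), ∀ u v, u ≠ v →
      truncWeight a (gap σ (fun z => (ℓ z : ℤ)) u v) = truncWeight a ⌊x u - x v⌋ := by
  set f : Fin n → ℝ := fun v => Int.fract (-x v) with hf
  set σ : Equiv.Perm (Fin n) := (Tuple.sort f).symm with hσ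
  set C : ℤ := ∑ v, |⌊-x v⌋| with hC
  have hnn : ∀ v, 0 ≤ ⌊-x v⌋ + C := by
    intro v
    have h1 : |⌊-x v⌋| ≤ C :=
      Finset.single_le_sum (f := fun v => |⌊-x v⌋|) (fun _ _ => abs_nonneg _) (Finset.mem_univ v)
    have h2 := neg_abs_le ⌊-x v⌋
    omega
  have hmono : ∀ u v, σ u ≤ σ v → f u ≤ f v := by
    intro u v h
    have := Tuple.monotone_sort f h
    simpa [hσ] using this
  refine ⟨σ, fun v => (⌊-x v⌋ + C).toNat, ?_⟩
  intro u v huv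
  have hav := hx u v huv
  have hdiff : x u - x v = ((⌊-x v⌋ - ⌊-x u⌋ : ℤ) : ℝ) + (f v - f u) := by
    have h1 := Int.floor_add_fract (-x u)
    have h2 := Int.floor_add_fract (-x v)
    simp only [hf]
    push_cast
    linarith
  have hu0 : 0 ≤ f u := Int.fract_nonneg _
  have hv0 : 0 ≤ f v := Int.fract_nonneg _
  have hu1 : f u < 1 := Int.fract_lt_one _
  have hv1 : f v < 1 := Int.fract_lt_one _
  have hto : ∀ z, ((⌊-x z⌋ + C).toNat : ℤ) = ⌊-x z⌋ + C := fun z => Int.toNat_of_nonneg (hnn z)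
  rcases lt_or_gt_of_ne (fun h => huv (σ.injective h) : σ u ≠ σ v) with hlt | hlt
  · rw [gap_of_lt hlt, hto, hto]
    congr 1
    have hle := hmono u v hlt.le
    symm
    rw [Int.floor_eq_iff, hdiff]
    push_cast
    constructor <;> linarith
  · rw [gap_of_gt hlt, hto, hto]
    rcases (hmono v u hlt.le).eq_or_lt with heq | hlt'
    · rw [heq, sub_self, add_zero] at hdiff
      rw [hdiff, Int.floor_intCast]
      apply truncWeight_congr ha
      by_contra hcon
      exact hav _ (by omega) (by omega) hdiff
    · congr 1
      symm
      rw [Int.floor_eq_iff, hdiff]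
      push_cast
      constructor <;> linarith

/-- Every point off the hyperplanes has the digraph of a labeled level sequence. Among all
nonnegative levels `ℓ` and positions `σ` with the right digraph, take one that minimizes `∑ ℓ` and
then `∑ ℓ σ`: if the first level were positive, rotating would decrease `∑ ℓ`, and at an increase
by `a` or more, swapping would decrease `∑ ℓ σ`. -/
theorem exists_isLevelSequence (ha : 1 ≤ a) {x : Fin n → ℝ} (hx : AvoidsHyperplanes a x) :
    ∃ (σ : Equiv.Perm (Fin n)) (L : Fin n → ℤ), IsLevelSequence a L ∧ ∀ u v, u ≠ v →
      truncWeight a (gap σ (L ∘ σ) u v) = truncWeight a ⌊x u - x v⌋ := by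
  let S : Set (Equiv.Perm (Fin n) × (Fin n → ℕ)) := {q | ∀ u v, u ≠ v →
    truncWeight a (gap q.1 (fun z => (q.2 z : ℤ)) u v) = truncWeight a ⌊x u - x v⌋}
  have hS : S.Nonempty := by
    obtain ⟨σ, ℓ, h⟩ := exists_gap_eq_floor ha hx
    exact ⟨(σ, ℓ), h⟩
  let r : Equiv.Perm (Fin n) × (Fin n → ℕ) → ℕ × ℕ :=
    fun q => (∑ z, q.2 z, ∑ z, q.2 z * (q.1 z : ℕ))
  have hwf : WellFounded (InvImage (Prod.Lex (· < ·) (· < ·)) r) :=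
    InvImage.wf r (WellFounded.prod_lex Nat.lt_wfRel.wf Nat.lt_wfRel.wf)
  obtain ⟨⟨σ, ℓ⟩, hmem, hmin⟩ := hwf.has_min S hS
  refine ⟨σ, fun p => (ℓ (σ.symm p) : ℤ), ⟨fun i => by positivity, ?_, ?_⟩, ?_⟩
  · intro i hi
    by_contra hpos
    have hpos' : 1 ≤ ℓ (σ.symm i) := by
      have : ℓ (σ.symm i) ≠ 0 := fun h => hpos (by simp only [h, Nat.cast_zero])
      omega
    obtain ⟨m, rfl⟩ : ∃ m, n = m + 1 := ⟨n - 1, by have := i.pos; omega⟩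
    have hi0 : i = 0 := Fin.ext hi
    subst hi0
    have hle : ∀ z, (if σ z = 0 then 1 else 0) ≤ ℓ z := by
      intro z
      split_ifs with h
      · rw [(Equiv.eq_symm_apply σ).2 h]; exact hpos'
      · exact Nat.zero_le _
    refine hmin (σ.trans (finRotate (m + 1)).symm, fun z => ℓ z - if σ z = 0 then 1 else 0) ?_ ?_
    · intro u v huv
      rw [← hmem u v huv, ← gap_rotate σ (fun z => (ℓ z : ℤ)) huv]
      congr 2
      funext z
      simp only
      rw [Nat.cast_sub (hle z)]
      split_ifs <;> simp
    · refine Prod.Lex.left _ _ (Finset.sum_lt_sum (fun z _ => Nat.sub_le _ _)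
        ⟨σ.symm 0, Finset.mem_univ _, ?_⟩)
      simp only [Equiv.apply_symm_apply, if_true]
      omega
  · intro i j hij
    by_contra hcon
    simp only [not_le] at hcon
    have hge : (ℓ (σ.symm i) : ℤ) + a ≤ ℓ (σ.symm j) := by omega
    refine hmin (σ.trans (Equiv.swap i j), ℓ) ?_ ?_
    · intro u v huv
      rw [← hmem u v huv]
      exact truncWeight_gap_swap ha σ _ hij hge u v
    · refine Prod.Lex.right _ ?_
      have h1 : ∀ g : Fin n → ℕ, ∑ z, ℓ z * g (σ z) = ∑ p, ℓ (σ.symm p) * g p := by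
        intro g
        rw [← Equiv.sum_comp σ fun p => ℓ (σ.symm p) * g p]
        simp
      have h2 := h1 fun p => (Equiv.swap i j p : ℕ)
      have h3 := h1 fun p => (p : ℕ)
      simp only [Equiv.trans_apply]
      rw [h2, h3]
      exact sum_mul_swap_lt (fun p => ℓ (σ.symm p)) hij (by omega)
  · intro u v huv
    rw [← hmem u v huv]
    congr 2
    funext z
    simp

end Normalization

/-! ### The encoding -/

section Encoding

variable {n a : ℕ}

lemma encode_apply (ha : 1 ≤ a) (π : Equiv.Perm (Fin n)) (Λ : CatalanPath a n) {u v : Fin n}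
    (huv : u ≠ v) : encode π Λ u v = truncWeight a (gap π.symm (Λ.upLevel ∘ π.symm) u v) := by
  have hne : π.symm u ≠ π.symm v := fun h => huv (π.symm.injective h)
  rw [encode, if_neg huv]
  split_ifs with h
  · rw [gap_of_lt h]
    rfl
  · rw [gap_of_gt (lt_of_le_of_ne (not_lt.1 h) hne.symm), reverseWeight_forwardWeight ha]
    congr 1
    simp only [level, Function.comp_apply]
    ring

lemma encode_self (π : Equiv.Perm (Fin n)) (Λ : CatalanPath a n) (u : Fin n) :
    encode π Λ u u = ⊥ := by
  simp [encode]

lemma encode_injective (ha : 1 ≤ a) : Function.Injective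
    fun p : Equiv.Perm (Fin n) × CatalanPath a n => encode p.1 p.2 := by
  rintro ⟨π, Λ⟩ ⟨π', Λ'⟩ h
  have hS : SameCell a π.symm π'.symm Λ.upLevel Λ'.upLevel := by
    intro u v huv
    rw [← truncWeight_eq_iff ha, ← encode_apply ha π Λ huv, ← encode_apply ha π' Λ' huv]
    exact congrFun (congrFun h u) v
  obtain ⟨h1, h2⟩ := hS.eq ha Λ.isLevelSequence Λ'.isLevelSequence
  rw [Equiv.symm_bijective.1 h1, CatalanPath.upLevel_injective h2]

/-- The point with `x v = -(level v + pos v / n)`, up to centring, has the encoded digraph. -/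
lemma exists_encode_eq_cellDigraph (ha : 1 ≤ a) (π : Equiv.Perm (Fin n)) (Λ : CatalanPath a n) :
    ∃ x ∈ complement (truncatedAffine n a a), encode π Λ = cellDigraph a x := by
  set y : Fin n → ℝ := fun v => Λ.upLevel (π.symm v) + (π.symm v : ℕ) / (n : ℝ) with hy
  set x : Fin n → ℝ := fun v => (∑ v, y v) / n - y v with hx
  have hbetween : ∀ u v, u ≠ v → (gap π.symm (Λ.upLevel ∘ π.symm) u v : ℝ) < x u - x v ∧
      x u - x v < (gap π.symm (Λ.upLevel ∘ π.symm) u v : ℝ) + 1 := by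
    intro u v huv
    have hn : (0 : ℝ) < n := by exact_mod_cast u.pos
    have hd : x u - x v = (Λ.upLevel (π.symm v) - Λ.upLevel (π.symm u)) +
        (((π.symm v : ℕ) : ℝ) / n - ((π.symm u : ℕ) : ℝ) / n) := by
      simp only [hx, hy]; ring
    have hfrac : ∀ p : Fin n, 0 ≤ ((p : ℕ) : ℝ) / n ∧ ((p : ℕ) : ℝ) / n < 1 := by
      intro p
      refine ⟨by positivity, ?_⟩
      rw [div_lt_one hn]
      exact_mod_cast p.2
    have hlt : ∀ p q : Fin n, p < q → ((p : ℕ) : ℝ) / n < ((q : ℕ) : ℝ) / n := by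
      intro p q hpq
      have : ((p : ℕ) : ℝ) < ((q : ℕ) : ℝ) := by exact_mod_cast Fin.lt_def.1 hpq
      gcongr
    have h1 := hfrac (π.symm u)
    have h2 := hfrac (π.symm v)
    rcases lt_or_gt_of_ne (fun h => huv (π.symm.injective h) : π.symm u ≠ π.symm v) with h | h
    · rw [gap_of_lt h, hd]
      have := hlt _ _ h
      simp only [Function.comp_apply]
      push_cast
      constructor <;> linarith
    · rw [gap_of_gt h, hd]
      have := hlt _ _ h
      simp only [Function.comp_apply]
      push_cast
      constructor <;> linarith
  refine ⟨x, mem_complement_iff.2 ⟨?_, ?_⟩, ?_⟩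
  · rcases Nat.eq_zero_or_pos n with rfl | hn
    · simp
    · have : (n : ℝ) ≠ 0 := by positivity
      simp only [hx]
      rw [Finset.sum_sub_distrib, Finset.sum_const, Finset.card_univ, Fintype.card_fin,
        nsmul_eq_mul]
      field_simp
      ring
  · intro u v huv k _ _ he
    obtain ⟨h1, h2⟩ := hbetween u v huv
    rw [he] at h1 h2
    have h1' : gap π.symm (Λ.upLevel ∘ π.symm) u v < k := by exact_mod_cast h1
    have h2' : k < gap π.symm (Λ.upLevel ∘ π.symm) u v + 1 := by exact_mod_cast h2
    omega
  · funext u v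
    by_cases huv : u = v
    · subst huv
      simp [encode_self, cellDigraph]
    · rw [encode_apply ha π Λ huv, cellDigraph, if_neg huv]
      congr 1
      symm
      obtain ⟨h1, h2⟩ := hbetween u v huv
      exact Int.floor_eq_iff.2 ⟨h1.le, h2⟩

lemma exists_cellDigraph_eq_encode (ha : 1 ≤ a) {x : Fin n → ℝ} (hx : AvoidsHyperplanes a x) :
    ∃ (π : Equiv.Perm (Fin n)) (Λ : CatalanPath a n), encode π Λ = cellDigraph a x := by
  obtain ⟨σ, L, hL, h⟩ := exists_isLevelSequence ha hx
  obtain ⟨Λ, rfl⟩ := hL.exists_path ha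
  refine ⟨σ.symm, Λ, ?_⟩
  funext u v
  by_cases huv : u = v
  · subst huv
    simp [encode_self, cellDigraph]
  · rw [encode_apply ha _ Λ huv, cellDigraph, if_neg huv, ← h u v huv]
    rfl

lemma IsValid.exists_eq_intCast (ha : 1 ≤ a) {w : WeightedDigraph n}
    (hw : IsValid (truncatedAffine n a a) w) (i j : Fin n) (hij : w i j ≠ ⊥) :
    ∃ k : ℤ, w i j = ((k : ℝ) : WithBot ℝ) := by
  rw [isValid_iff ha] at hw
  obtain ⟨d, hd, -⟩ := hw.2 i j fun h => hij (h ▸ hw.1 i)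
  rcases lt_or_ge d (1 - (a : ℤ)) with h | h
  · exact absurd (hd.trans (truncWeight_of_lt h)) hij
  · exact ⟨_, hd.trans (truncWeight_of_le h)⟩

end Encoding

end BraidDeformation

theorem mainTheorem5 (a n : ℕ) (ha : 1 ≤ a) :
    Set.BijOn
      (fun p : Equiv.Perm (Fin n) × BraidDeformation.CatalanPath a n =>
        BraidDeformation.encode p.1 p.2)
      Set.univ
      {w | BraidDeformation.IsValid (BraidDeformation.truncatedAffine n a a) w ∧
        BraidDeformation.IsMAcyclic w} ∧
    Set.BijOn
      (fun p : Equiv.Perm (Fin n) × BraidDeformation.CatalanPath a n =>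
        BraidDeformation.polytope (BraidDeformation.encode p.1 p.2))
      Set.univ
      (BraidDeformation.regions (BraidDeformation.truncatedAffine n a a)) := by
  refine ⟨⟨?_, (BraidDeformation.encode_injective ha).injOn, ?_⟩, ⟨?_, ?_, ?_⟩⟩
  · rintro ⟨π, Λ⟩ -
    obtain ⟨x, hx, he⟩ := BraidDeformation.exists_encode_eq_cellDigraph ha π Λ
    obtain ⟨h0, hav⟩ := BraidDeformation.mem_complement_iff.1 hx
    simp only [he]
    exact ⟨BraidDeformation.isValid_cellDigraph ha hav,
      BraidDeformation.isMAcyclic_of_mem_polytope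
        (BraidDeformation.mem_polytope_cellDigraph ha h0 hav)⟩
  · rintro w ⟨hval, hac⟩
    obtain ⟨x, hx⟩ :=
      BraidDeformation.polytope_nonempty_of_isMAcyclic (hval.exists_eq_intCast ha) hac
    obtain ⟨rfl, hav⟩ := BraidDeformation.eq_cellDigraph_of_mem_polytope ha hval hx
    obtain ⟨π, Λ, he⟩ := BraidDeformation.exists_cellDigraph_eq_encode ha hav
    exact ⟨(π, Λ), Set.mem_univ _, he⟩
  · rintro ⟨π, Λ⟩ -
    obtain ⟨x, hx, he⟩ := BraidDeformation.exists_encode_eq_cellDigraph ha π Λ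
    simp only [he]
    exact ⟨x, hx, (BraidDeformation.connectedComponentIn_eq_polytope ha hx).symm⟩
  · -- Both digraphs are recovered from a common point of their polytopes.
    rintro ⟨π, Λ⟩ - ⟨π', Λ'⟩ - h
    obtain ⟨x, hx, he⟩ := BraidDeformation.exists_encode_eq_cellDigraph ha π Λ
    obtain ⟨x', hx', he'⟩ := BraidDeformation.exists_encode_eq_cellDigraph ha π' Λ'
    obtain ⟨h0, hav⟩ := BraidDeformation.mem_complement_iff.1 hx
    have hmem := BraidDeformation.mem_polytope_cellDigraph ha h0 hav
    simp only [he, he'] at h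
    rw [h] at hmem
    have heq := (BraidDeformation.eq_cellDigraph_of_mem_polytope ha
      (BraidDeformation.isValid_cellDigraph ha (BraidDeformation.mem_complement_iff.1 hx').2)
      hmem).1
    apply BraidDeformation.encode_injective ha
    simp only [he, he', heq]
  · rintro R ⟨x, hx, rfl⟩
    obtain ⟨π, Λ, he⟩ := BraidDeformation.exists_cellDigraph_eq_encode ha
      (BraidDeformation.mem_complement_iff.1 hx).2
    refine ⟨(π, Λ), Set.mem_univ _, ?_⟩
    simp only [he]
    exact (BraidDeformation.connectedComponentIn_eq_polytope ha hx).symm
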